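/- Let $(B,g_B)$ and $(F,g_F)$ be smooth pseudo-Riemannian manifolds (without boundary) of dimensions $m$ and $k$, and let $c,w\colon B\to(0,\infty)$ be smooth functions. The \emph{base conformal warped product} of $B$ and $F$ is the product manifold $B\times F$, with projections $\pi\colon B\times F\to B$ and $\sigma\colon B\times F\to F$, furnished with the pseudo-Riemannian metric $$g=(c\circ\pi)^2\,\pi^*g_B\oplus(w\circ\pi)^2\,\sigma^*g_F .$$ The curvature convention is $R(X,Y)Z=\nabla_X\nabla_YZ-\nabla_Y\nabla_XZ-\nabla_{[X,Y]}Z$, and $\mathrm{Ric}(X,Y)$ is the trace of $E\mapsto R(E,Y)X$. Write $\mathrm{Ric}$, $\mathrm{Ric}_B$, $\mathrm{Ric}_F$ for the Ricci tensors of $g$, $g_B$, $g_F$. On $(B,g_B)$ write $\nabla^B$ for the gradient, $\mathrm H_B^{f}(X,Y)=X(Yf)-(\nabla_XY)f$ for the Hessian of a function $f$ and $\Delta_B=\nabla^{B\,i}\nabla^B_{\,i}$ for the Laplace–Beltrami operator. Tangent vectors of $B$ and of $F$ are identified with their lifts to $B\times F$. Then, for all $p\in B$, $q\in F$, all $X,Y\in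 T_pB$ and all $V,W\in T_qF$, the following hold at $(p,q)$ (with the functions on $B$ evaluated at $p$). 1. $$\begin{aligned}\mathrm{Ric}(X,Y)={}&\mathrm{Ric}_B(X,Y)-(m-2)\frac1c\,\mathrm H_B^c(X,Y)+2(m-2)\frac1{c^2}\,X(c)\,Y(c)\\&-\left[(m-3)\frac{g_B(\nabla^Bc,\nabla^Bc)}{c^2}+\frac{\Delta_Bc}{c}\right]g_B(X,Y)\\&-k\,\frac1w\,\mathrm H_B^w(X,Y)-k\,\frac{g_B(\nabla^Bw,\nabla^Bc)}{wc}\,g_B(X,Y)+k\,\frac{X(c)}{c}\frac{Y(w)}{w}+k\,\frac{Y(c)}{c}\frac{X(w)}{w}.\end{aligned}$$ 2. $\mathrm{Ric}(X,V)=\mathrm{Ric}(V,X)=0$. 3. $$\mathrm{Ric}(V,W)=\mathrm{Ric}_F(V,W)-\frac{w^2}{c^2}\,g_F(V,W)\left[(m-2)\frac{g_B(\nabla^Bw,\nabla^Bc)}{wc}+\frac{\Delta_Bw}{w}+(k-1)\frac{g_B(\nabla^Bw,\nabla^Bw)}{w^2}\right].$$ -/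

import Mathlib

open scoped Manifold ContDiff Bundle Topology

noncomputable section

/-! ### Pseudo-Riemannian geometry of a metric `G` on an open subset of a vector space

Here `G u` is the scalar product at the point `u`.  A linear coordinate system turns these
definitions into the classical component formulas. -/

namespace ChartGeometry

variable {E : Type*} [NormedAddCommGroup E] [NormedSpace ℝ E]

/-- The Christoffel symbol `Γ_u(v, w)`: the vector which satisfies, for all `a`,
`2 G(Γ(v, w), a) = (∂_v G)(w, a) + (∂_w G)(v, a) - (∂_a G)(v, w)` at `u`. -/
def christoffel (G : E → E →L[ℝ] E →L[ℝ] ℝ) (u v w : E) : E :=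
  (G u).inverse ((1 / 2 : ℝ) •
    (fderiv ℝ G u v w + fderiv ℝ G u w v - ((fderiv ℝ G u).flip v).flip w))

/-- The Levi-Civita covariant derivative `∇_X Y` of vector fields. -/
def covDeriv (G : E → E →L[ℝ] E →L[ℝ] ℝ) (X Y : E → E) (u : E) : E :=
  fderiv ℝ Y u (X u) + christoffel G u (X u) (Y u)

/-- The curvature `R(X, Y) Z = ∇_X ∇_Y Z - ∇_Y ∇_X Z - ∇_[X, Y] Z`. -/
def curvature (G : E → E →L[ℝ] E →L[ℝ] ℝ) (X Y Z : E → E) (u : E) : E :=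
  covDeriv G X (covDeriv G Y Z) u - covDeriv G Y (covDeriv G X Z) u
    - covDeriv G (VectorField.lieBracket ℝ X Y) Z u

/-- The trace of a linear map `A : E → E`, written in a basis. -/
def traceMap [FiniteDimensional ℝ E] (A : E → E) : ℝ :=
  ∑ i, (Module.finBasis ℝ E).coord i (A (Module.finBasis ℝ E i))

/-- The Ricci tensor at `u`: `Ric(x, y)` is the trace of `e ↦ R(e, y) x`, that is
`∑ i, G(e_i, e_i) G(R(e_i, y) x, e_i)` for an orthonormal basis `e_i`.  The curvature is a
tensor, so vectors are extended to constant fields. -/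
def ricci [FiniteDimensional ℝ E] (G : E → E →L[ℝ] E →L[ℝ] ℝ) (u x y : E) : ℝ :=
  traceMap fun e : E ↦ curvature G (fun _ ↦ e) (fun _ ↦ y) (fun _ ↦ x) u

/-- The gradient of a function: `G(grad f, v) = df(v)`. -/
def grad (G : E → E →L[ℝ] E →L[ℝ] ℝ) (f : E → ℝ) (u : E) : E :=
  (G u).inverse (fderiv ℝ f u)

/-- The Hessian `H^f(x, y) = x (y f) - (∇_x y) f`, with `x` and `y` extended to constant fields. -/
def hessian (G : E → E →L[ℝ] E →L[ℝ] ℝ) (f : E → ℝ) (u x y : E) : ℝ :=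
  fderiv ℝ (fun u' ↦ fderiv ℝ f u' y) u x
    - fderiv ℝ f u (covDeriv G (fun _ ↦ x) (fun _ ↦ y) u)

/-- The Laplace-Beltrami operator `Δ f = ∇^i ∇_i f`: the divergence of the gradient, that is the
trace of `e ↦ ∇_e (grad f)`. -/
def laplacian [FiniteDimensional ℝ E] (G : E → E →L[ℝ] E →L[ℝ] ℝ) (f : E → ℝ) (u : E) : ℝ :=
  traceMap fun e : E ↦ covDeriv G (fun _ ↦ e) (grad G f) u

end ChartGeometry

/-! ### Pseudo-Riemannian manifolds

The differential operators at a point are computed in the preferred chart around that point.  They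
do not depend on the choice of the chart.  They are used for manifolds without boundary only. -/

section Manifold

variable {E : Type*} [NormedAddCommGroup E] [NormedSpace ℝ E]
  {H : Type*} [TopologicalSpace H]

/-- A smooth pseudo-Riemannian metric on a smooth manifold: a smooth field of symmetric
nondegenerate bilinear forms on the tangent spaces. -/
structure PseudoRiemannianMetric (I : ModelWithCorners ℝ E H) (M : Type*) [TopologicalSpace M]
    [ChartedSpace H M] [IsManifold I ∞ M] where
  /-- The scalar product on the tangent spaces. -/
  val (x : M) : TangentSpace I x →L[ℝ] TangentSpace I x →L[ℝ] ℝ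
  symm (x : M) (v w : TangentSpace I x) : val x v w = val x w v
  nondegenerate (x : M) (v : TangentSpace I x) (hv : ∀ w, val x v w = 0) : v = 0
  contMDiff : ContMDiff I (I.prod 𝓘(ℝ, E →L[ℝ] E →L[ℝ] ℝ)) ∞
    (fun x ↦ Bundle.TotalSpace.mk' (E →L[ℝ] E →L[ℝ] ℝ)
      (E := fun x : M ↦ TangentSpace I x →L[ℝ] TangentSpace I x →L[ℝ] ℝ) x (val x))

namespace PseudoRiemannianMetric

variable {I : ModelWithCorners ℝ E H} {M : Type*} [TopologicalSpace M]
  [ChartedSpace H M] [IsManifold I ∞ M] (g : PseudoRiemannianMetric I M)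

/-- The metric written in the preferred chart around `x`: its pullback under the inverse chart. -/
def inChart (x : M) (u : E) : E →L[ℝ] E →L[ℝ] ℝ :=
  letI D : E →L[ℝ] TangentSpace I ((extChartAt I x).symm u) :=
    mfderivWithin 𝓘(ℝ, E) I (extChartAt I x).symm (Set.range I) u
  (ContinuousLinearMap.precomp ℝ D) ∘L (g.val ((extChartAt I x).symm u)) ∘L D

/-- The Ricci tensor at `x`, computed in the preferred chart around `x`; by definition
`TangentSpace I x` is the model space `E`, seen through this chart. -/
def ricci [FiniteDimensional ℝ E] (x : M) (v w : TangentSpace I x) : ℝ :=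
  ChartGeometry.ricci (g.inChart x) (extChartAt I x x) v w

/-- The Hessian of `f` at `x`, computed in the preferred chart around `x`. -/
def hessian (f : M → ℝ) (x : M) (v w : TangentSpace I x) : ℝ :=
  ChartGeometry.hessian (g.inChart x) (f ∘ (extChartAt I x).symm) (extChartAt I x x) v w

/-- The Laplace-Beltrami operator applied to `f`, at `x`, computed in the preferred chart
around `x`. -/
def laplacian [FiniteDimensional ℝ E] (f : M → ℝ) (x : M) : ℝ :=
  ChartGeometry.laplacian (g.inChart x) (f ∘ (extChartAt I x).symm) (extChartAt I x x)

/-- The gradient of `f` at `x`: `g(grad f, v) = df(v)`. -/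
def grad (f : M → ℝ) (x : M) : TangentSpace I x :=
  (g.val x).inverse (mvfderiv I f x)

end PseudoRiemannianMetric

end Manifold

section BaseConformalWarpedProduct

/-- A field of bilinear forms on the tangent spaces is smooth at `x₀` if and only if its
coordinate expression in the preferred chart around `x₀` is. -/
lemma contMDiffAt_bilinForm_iff {E : Type*} [NormedAddCommGroup E] [NormedSpace ℝ E]
    {H : Type*} [TopologicalSpace H] {I : ModelWithCorners ℝ E H} {M : Type*}
    [TopologicalSpace M] [ChartedSpace H M] [IsManifold I ∞ M]
    (s : ∀ x : M, TangentSpace I x →L[ℝ] TangentSpace I x →L[ℝ] ℝ) (x₀ : M) :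
    ContMDiffAt I (I.prod 𝓘(ℝ, E →L[ℝ] E →L[ℝ] ℝ)) ∞
      (fun x ↦ Bundle.TotalSpace.mk' (E →L[ℝ] E →L[ℝ] ℝ)
        (E := fun x : M ↦ TangentSpace I x →L[ℝ] TangentSpace I x →L[ℝ] ℝ) x (s x)) x₀ ↔
    ContMDiffAt I 𝓘(ℝ, E →L[ℝ] E →L[ℝ] ℝ) ∞ (fun x ↦
      letI D : E →L[ℝ] TangentSpace I x :=
        mfderivWithin 𝓘(ℝ, E) I (extChartAt I x₀).symm (Set.range I) (extChartAt I x₀ x)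
      ((ContinuousLinearMap.precomp ℝ D) ∘L (s x) ∘L D : E →L[ℝ] E →L[ℝ] ℝ)) x₀ := by
  rw [Bundle.contMDiffAt_section]
  apply Filter.EventuallyEq.contMDiffAt_iff
  filter_upwards [(chartAt H x₀).open_source.mem_nhds (mem_chart_source H x₀)] with x hx
  ext v w
  rw [hom_trivializationAt_apply, inCoordinates_apply_eq₂ (by simpa using hx)
    (by simpa using hx) (by simp), ← TangentBundle.symmL_trivializationAt hx]
  have he : x ∈ (trivializationAt E (TangentSpace I) x₀).baseSet := by simpa using hx
  simp [(trivializationAt E (TangentSpace I) x₀).symmL_apply he]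

variable {EB : Type*} [NormedAddCommGroup EB] [NormedSpace ℝ EB]
  {HB : Type*} [TopologicalSpace HB] {IB : ModelWithCorners ℝ EB HB}
  {B : Type*} [TopologicalSpace B] [ChartedSpace HB B] [IsManifold IB ∞ B]
  {EF : Type*} [NormedAddCommGroup EF] [NormedSpace ℝ EF]
  {HF : Type*} [TopologicalSpace HF] {IF : ModelWithCorners ℝ EF HF}
  {F : Type*} [TopologicalSpace F] [ChartedSpace HF F] [IsManifold IF ∞ F]

/-- The bilinear form `c² π^* g_B + w² σ^* g_F` on the tangent space of `B × F` at `x`, where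
`π` and `σ` are the projections. -/
def bcwpForm (gB : PseudoRiemannianMetric IB B) (gF : PseudoRiemannianMetric IF F) (c w : B → ℝ)
    (x : B × F) :
    TangentSpace (IB.prod IF) x →L[ℝ] TangentSpace (IB.prod IF) x →L[ℝ] ℝ :=
  letI dπ : TangentSpace (IB.prod IF) x →L[ℝ] TangentSpace IB x.1 :=
    mfderiv (IB.prod IF) IB Prod.fst x
  letI dσ : TangentSpace (IB.prod IF) x →L[ℝ] TangentSpace IF x.2 :=
    mfderiv (IB.prod IF) IF Prod.snd x
  (c x.1) ^ 2 • (ContinuousLinearMap.precomp ℝ dπ ∘L gB.val x.1 ∘L dπ) +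
    (w x.1) ^ 2 • (ContinuousLinearMap.precomp ℝ dσ ∘L gF.val x.2 ∘L dσ)

lemma bcwpForm_apply (gB : PseudoRiemannianMetric IB B) (gF : PseudoRiemannianMetric IF F)
    (c w : B → ℝ) (p : B) (q : F) (X X' : TangentSpace IB p) (V V' : TangentSpace IF q) :
    bcwpForm gB gF c w (p, q) (X, V) (X', V') =
      c p ^ 2 * gB.val p X X' + w p ^ 2 * gF.val q V V' := by
  simp [bcwpForm, mfderiv_fst, mfderiv_snd]
  rfl

/-- The inverse of a product chart has the product derivative. -/
lemma mfderivWithin_extChartAt_symm_prod (p : B) (q : F) (u : EB) (v : EF)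
    (hu : u ∈ (extChartAt IB p).target) (hv : v ∈ (extChartAt IF q).target) :
    mfderivWithin 𝓘(ℝ, EB × EF) (IB.prod IF) (extChartAt (IB.prod IF) (p, q)).symm
        (Set.range (IB.prod IF)) (u, v) =
      (mfderivWithin 𝓘(ℝ, EB) IB (extChartAt IB p).symm (Set.range IB) u).prodMap
        (mfderivWithin 𝓘(ℝ, EF) IF (extChartAt IF q).symm (Set.range IF) v) := by
  rw [modelWithCornersSelf_prod, ← chartedSpaceSelf_prod]
  rw [show Set.range (IB.prod IF) = Set.range IB ×ˢ Set.range IF from Set.range_prodMap]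
  rw [show ((extChartAt (IB.prod IF) (p, q)).symm : EB × EF → B × F) =
      Prod.map (extChartAt IB p).symm (extChartAt IF q).symm by rw [extChartAt_prod]; rfl]
  refine mfderivWithin_prodMap (p := (u, v)) ?_ ?_ ?_ ?_
  · exact mdifferentiableWithinAt_extChartAt_symm hu
  · exact mdifferentiableWithinAt_extChartAt_symm hv
  · exact IB.uniqueMDiffOn u (extChartAt_target_subset_range p hu)
  · exact IF.uniqueMDiffOn v (extChartAt_target_subset_range q hv)

/-- The base conformal warped product: the manifold `B × F` with the metric
`c² g_B ⊕ w² g_F`, where `c` is the conformal factor and `w` is the warping function. -/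
def bcwp (gB : PseudoRiemannianMetric IB B) (gF : PseudoRiemannianMetric IF F) (c w : B → ℝ)
    (hc : ContMDiff IB 𝓘(ℝ) ∞ c) (hw : ContMDiff IB 𝓘(ℝ) ∞ w)
    (hc0 : ∀ p, 0 < c p) (hw0 : ∀ p, 0 < w p) :
    PseudoRiemannianMetric (IB.prod IF) (B × F) where
  val := bcwpForm gB gF c w
  symm := by
    rintro ⟨p, q⟩ ⟨X, V⟩ ⟨X', V'⟩
    have h := bcwpForm_apply gB gF c w p q X X' V V'
    have h' := bcwpForm_apply gB gF c w p q X' X V' V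
    rw [gB.symm p X' X, gF.symm q V' V] at h'
    exact h.trans h'.symm
  nondegenerate := by
    rintro ⟨p, q⟩ ⟨X, V⟩ h
    have hX : X = 0 := gB.nondegenerate p X fun X' ↦ by
      have h1 := (bcwpForm_apply gB gF c w p q X X' V 0).symm.trans (h (X', 0))
      simpa [(hc0 p).ne'] using h1
    have hV : V = 0 := gF.nondegenerate q V fun V' ↦ by
      have h1 := (bcwpForm_apply gB gF c w p q X 0 V V').symm.trans (h (0, V'))
      simpa [(hw0 p).ne'] using h1
    rw [hX, hV]
    rfl
  contMDiff := by
    rintro ⟨p, q⟩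
    rw [contMDiffAt_bilinForm_iff]
    have hB := ((contMDiffAt_bilinForm_iff gB.val p).1 (gB.contMDiff p)).comp
      ((p, q) : B × F) (contMDiffAt_fst (I := IB) (J := IF))
    have hF := ((contMDiffAt_bilinForm_iff gF.val q).1 (gF.contMDiff q)).comp
      ((p, q) : B × F) (contMDiffAt_snd (I := IB) (J := IF))
    have hc' := (hc p).comp ((p, q) : B × F) (contMDiffAt_fst (I := IB) (J := IF))
    have hw' := (hw p).comp ((p, q) : B × F) (contMDiffAt_fst (I := IB) (J := IF))
    have h1 := (hc'.pow 2).smul ((contMDiffAt_const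
      (c := ContinuousLinearMap.precomp ℝ (ContinuousLinearMap.fst ℝ EB EF))).clm_comp
        (hB.clm_comp (contMDiffAt_const (c := ContinuousLinearMap.fst ℝ EB EF))))
    have h2 := (hw'.pow 2).smul ((contMDiffAt_const
      (c := ContinuousLinearMap.precomp ℝ (ContinuousLinearMap.snd ℝ EB EF))).clm_comp
        (hF.clm_comp (contMDiffAt_const (c := ContinuousLinearMap.snd ℝ EB EF))))
    refine (h1.add h2).congr_of_eventuallyEq ?_
    filter_upwards [prod_mem_nhds ((chartAt HB p).open_source.mem_nhds (mem_chart_source HB p))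
      ((chartAt HF q).open_source.mem_nhds (mem_chart_source HF q))] with x hx
    have hD := mfderivWithin_extChartAt_symm_prod (IB := IB) (IF := IF) p q
      (extChartAt IB p x.1) (extChartAt IF q x.2)
      ((extChartAt IB p).map_source (by simpa using hx.1))
      ((extChartAt IF q).map_source (by simpa using hx.2))
    have hx' : extChartAt (IB.prod IF) (p, q) x = (extChartAt IB p x.1, extChartAt IF q x.2) := by
      rw [extChartAt_prod]
      rfl
    refine ContinuousLinearMap.ext fun v ↦ ContinuousLinearMap.ext fun v' ↦ ?_
    rw [hx', hD]
    exact bcwpForm_apply gB gF c w x.1 x.2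
      (mfderivWithin 𝓘(ℝ, EB) IB (extChartAt IB p).symm (Set.range IB) (extChartAt IB p x.1) v.1)
      (mfderivWithin 𝓘(ℝ, EB) IB (extChartAt IB p).symm (Set.range IB) (extChartAt IB p x.1) v'.1)
      (mfderivWithin 𝓘(ℝ, EF) IF (extChartAt IF q).symm (Set.range IF) (extChartAt IF q x.2) v.2)
      (mfderivWithin 𝓘(ℝ, EF) IF (extChartAt IF q).symm (Set.range IF) (extChartAt IF q x.2) v'.2)

/-- The lift to `(p, q)` of a tangent vector of `B` at `p`: its image under the derivative of the
inclusion `b ↦ (b, q)`. -/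
def liftBase (p : B) (q : F) (X : TangentSpace IB p) : TangentSpace (IB.prod IF) (p, q) :=
  mfderiv IB (IB.prod IF) (fun b : B ↦ (b, q)) p X

/-- The lift to `(p, q)` of a tangent vector of `F` at `q`: its image under the derivative of the
inclusion `f ↦ (p, f)`. -/
def liftFiber (p : B) (q : F) (V : TangentSpace IF q) : TangentSpace (IB.prod IF) (p, q) :=
  mfderiv IF (IB.prod IF) (fun f : F ↦ (p, f)) q V

end BaseConformalWarpedProduct

end

/-! The assertion is local, so it is proved for metrics on open subsets of vector spaces. In the
product chart the total metric is `c² GB ⊕ w² GF`, and its Koszul formula can be solved in closed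
form (`IsWarpedAt.christoffel_eq`). With `D = conformalDiff`, two base vectors give `Γ_B + D`, a
base vector `x` acts on a fibre vector by the factor `dw(x)/w`, and two fibre vectors give `Γ_F`
together with the base component `-(w/c²) g_F ∇w`.

Differentiating these symbols gives the curvature, and `traceMap_prod` splits the Ricci tensor into
a base block and a fibre block. For base arguments the base block is the curvature of `c² g_B`,
contracted in `ricci_conformal`. The fibre block is the scalar `-Hess(w)/w`, with the Hessian of `c²
g_B`, and its trace brings the factor `k`. For fibre arguments the base block is `-w g_F(V, W)`
times the covariant derivative of the gradient of `w`, both taken for `c² g_B`. The fibre block is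
`R_F` plus a term of constant-curvature type with coefficient `|∇w|²/c²`, whose trace brings `k -
1`. For mixed arguments the surviving terms cancel. -/

noncomputable section

set_option maxSynthPendingDepth 3

namespace ChartGeometry

variable {E : Type*} [NormedAddCommGroup E] [NormedSpace ℝ E]

/-! ### Traces of endomorphisms. -/

section Trace

variable [FiniteDimensional ℝ E]

lemma traceMap_eq_trace (A : E →ₗ[ℝ] E) : traceMap A = LinearMap.trace ℝ E A := by
  rw [LinearMap.trace_eq_matrix_trace ℝ (Module.finBasis ℝ E), Matrix.trace]
  simp [traceMap, LinearMap.toMatrix_apply]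

lemma traceMap_add (A A' : E → E) :
    traceMap (fun e ↦ A e + A' e) = traceMap A + traceMap A' := by
  simp [traceMap, Finset.sum_add_distrib]

lemma traceMap_sub (A A' : E → E) :
    traceMap (fun e ↦ A e - A' e) = traceMap A - traceMap A' := by
  simp [traceMap, Finset.sum_sub_distrib]

lemma traceMap_smul (r : ℝ) (A : E → E) : traceMap (fun e ↦ r • A e) = r * traceMap A := by
  simp [traceMap, Finset.mul_sum]

lemma traceMap_id : traceMap (fun e : E ↦ e) = Module.finrank ℝ E :=
  (traceMap_eq_trace LinearMap.id).trans (LinearMap.trace_id ℝ E)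

/-- Contracts the rank-one terms of the curvature. Together with `traceMap_id` it produces all the
dimensional coefficients in the final formulas. -/
lemma traceMap_smulRight (f : E →L[ℝ] ℝ) (v : E) : traceMap (fun e ↦ f e • v) = f v := by
  conv_rhs => rw [← (Module.finBasis ℝ E).sum_repr v]
  simp only [traceMap, map_sum, map_smul, smul_eq_mul, Module.Basis.coord_apply]
  exact Finset.sum_congr rfl fun i _ ↦ mul_comm _ _

/-- The trace on a product is the sum of the traces of the diagonal blocks. -/
lemma traceMap_prod {F : Type*} [NormedAddCommGroup F] [NormedSpace ℝ F]
    [FiniteDimensional ℝ F] (A : E × F →ₗ[ℝ] E × F) :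
    traceMap A = traceMap (fun e : E ↦ (A (e, 0)).1) + traceMap (fun f : F ↦ (A (0, f)).2) := by
  rw [traceMap_eq_trace, LinearMap.trace_eq_matrix_trace ℝ
    ((Module.finBasis ℝ E).prod (Module.finBasis ℝ F)), Matrix.trace, Fintype.sum_sum_type]
  simp [traceMap, LinearMap.toMatrix_apply]

end Trace

/-! ### The Levi-Civita connection, gradient and Hessian of a metric in coordinates. -/

/-- `G` is a twice continuously differentiable field of scalar products near `u`. -/
structure IsMetricAt (G : E → E →L[ℝ] E →L[ℝ] ℝ) (u : E) : Prop where
  contDiffAt : ContDiffAt ℝ 2 G u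
  symm : ∀ᶠ u' in 𝓝 u, ∀ v w, G u' v w = G u' w v
  isInvertible : (G u).IsInvertible

lemma christoffel_add_left (G : E → E →L[ℝ] E →L[ℝ] ℝ) (u v v' w : E) :
    christoffel G u (v + v') w = christoffel G u v w + christoffel G u v' w := by
  simp only [christoffel, ← map_add, ← smul_add]
  congr 2
  ext a
  simp
  ring

lemma christoffel_smul_left (G : E → E →L[ℝ] E →L[ℝ] ℝ) (u v w : E) (r : ℝ) :
    christoffel G u (r • v) w = r • christoffel G u v w := by
  simp only [christoffel, ← map_smul]
  congr 1
  ext a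
  simp
  ring

lemma christoffel_add_right (G : E → E →L[ℝ] E →L[ℝ] ℝ) (u v w w' : E) :
    christoffel G u v (w + w') = christoffel G u v w + christoffel G u v w' := by
  simp only [christoffel, ← map_add, ← smul_add]
  congr 2
  ext a
  simp
  ring

lemma christoffel_smul_right (G : E → E →L[ℝ] E →L[ℝ] ℝ) (u v w : E) (r : ℝ) :
    christoffel G u v (r • w) = r • christoffel G u v w := by
  simp only [christoffel, ← map_smul]
  congr 1
  ext a
  simp
  ring

lemma christoffel_zero_left (G : E → E →L[ℝ] E →L[ℝ] ℝ) (u w : E) :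
    christoffel G u 0 w = 0 := by
  simpa using christoffel_smul_left G u 0 w 0

lemma christoffel_zero_right (G : E → E →L[ℝ] E →L[ℝ] ℝ) (u v : E) :
    christoffel G u v 0 = 0 := by
  simpa using christoffel_smul_right G u v 0 0

lemma covDeriv_const (G : E → E →L[ℝ] E →L[ℝ] ℝ) (x y : E) :
    covDeriv G (fun _ ↦ x) (fun _ ↦ y) = fun u ↦ christoffel G u x y := by
  ext u
  simp [covDeriv]

/-- The curvature in terms of the Christoffel symbols. -/
lemma curvature_const (G : E → E →L[ℝ] E →L[ℝ] ℝ) (u x y z : E) :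
    curvature G (fun _ ↦ x) (fun _ ↦ y) (fun _ ↦ z) u =
      fderiv ℝ (fun u' ↦ christoffel G u' y z) u x + christoffel G u x (christoffel G u y z)
      - (fderiv ℝ (fun u' ↦ christoffel G u' x z) u y
        + christoffel G u y (christoffel G u x z)) := by
  simp only [curvature, covDeriv_const]
  simp [covDeriv, VectorField.lieBracket, christoffel_zero_left]

lemma differentiableAt_fderiv_apply {f : E → ℝ} {u : E} (hf : ContDiffAt ℝ 2 f u) (y : E) :
    DifferentiableAt ℝ (fun u' ↦ fderiv ℝ f u' y) u :=
  ((hf.fderiv_right (m := 1) (by norm_num)).differentiableAt (by norm_num)).clm_apply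
    (differentiableAt_const y)

namespace IsMetricAt

variable {G : E → E →L[ℝ] E →L[ℝ] ℝ} {u : E}

section

variable (h : IsMetricAt G u)
include h

lemma apply_symm (v w : E) : G u v w = G u w v := h.symm.self_of_nhds v w

lemma differentiableAt : DifferentiableAt ℝ G u := h.contDiffAt.differentiableAt (by norm_num)

lemma differentiableAt_apply (v w : E) : DifferentiableAt ℝ (fun u' ↦ G u' v w) u :=
  (h.differentiableAt.clm_apply (differentiableAt_const v)).clm_apply (differentiableAt_const w)

lemma fderiv_apply (a v w : E) : fderiv ℝ (fun u' ↦ G u' v w) u a = fderiv ℝ G u a v w := by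
  rw [fderiv_clm_apply (h.differentiableAt.clm_apply (differentiableAt_const v))
    (differentiableAt_const w), fderiv_clm_apply h.differentiableAt (differentiableAt_const v)]
  simp

lemma fderiv_symm (a v w : E) : fderiv ℝ G u a v w = fderiv ℝ G u a w v := by
  rw [← h.fderiv_apply, ← h.fderiv_apply]
  congr 1
  exact Filter.EventuallyEq.fderiv_eq (h.symm.mono fun u' hu' ↦ hu' v w)

/-- Nondegeneracy: vectors defined only through their scalar products, such as Christoffel symbols,
are identified by pairing with an arbitrary vector. -/
lemma ext {v w : E} (hvw : ∀ a, G u v a = G u w a) : v = w :=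
  h.isInvertible.injective (ContinuousLinearMap.ext hvw)

lemma apply_inverse (f : E →L[ℝ] ℝ) (a : E) : G u ((G u).inverse f) a = f a := by
  rw [h.isInvertible.self_apply_inverse]

/-- The defining property of the Christoffel symbol. -/
lemma apply_christoffel (v w a : E) : G u (christoffel G u v w) a =
    1 / 2 * (fderiv ℝ G u v w a + fderiv ℝ G u w v a - fderiv ℝ G u a v w) := by
  rw [christoffel, h.apply_inverse]
  simp

lemma christoffel_symm (v w : E) : christoffel G u v w = christoffel G u w v := by
  refine h.ext fun a ↦ ?_
  rw [h.apply_christoffel, h.apply_christoffel, h.fderiv_symm a v w]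
  ring

/-- The Levi-Civita connection is metric. -/
lemma fderiv_eq (a v w : E) : fderiv ℝ G u a v w =
    G u (christoffel G u a v) w + G u v (christoffel G u a w) := by
  rw [h.apply_symm v, h.apply_christoffel, h.apply_christoffel, h.fderiv_symm a w v,
    h.fderiv_symm v a w, h.fderiv_symm w a v]
  ring

lemma apply_grad (f : E → ℝ) (v : E) : G u (grad G f u) v = fderiv ℝ f u v :=
  h.apply_inverse _ v

lemma fderiv_grad_symm (f f' : E → ℝ) :
    fderiv ℝ f u (grad G f' u) = fderiv ℝ f' u (grad G f u) := by
  rw [← h.apply_grad, ← h.apply_grad, h.apply_symm]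

variable [CompleteSpace E]

/-- Invertible operators form an open set, so invertibility at the single point `u` suffices.
Pointwise identities thereby hold near `u` and can be differentiated. -/
lemma eventually : ∀ᶠ u' in 𝓝 u, IsMetricAt G u' := by
  have h1 : ∀ᶠ u' in 𝓝 u, (G u').IsInvertible := by
    obtain ⟨e, he⟩ := h.isInvertible
    refine h.contDiffAt.continuousAt.eventually_mem
      (ContinuousLinearEquiv.isOpen.mem_nhds ⟨e, he⟩) |>.mono ?_
    rintro u' ⟨e', he'⟩
    exact ⟨e', he'⟩
  filter_upwards [h1, h.symm.eventually_nhds, h.contDiffAt.eventually (by norm_num)]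
    with u' h1 h2 h3 using ⟨h3, h2, h1⟩

lemma contDiffAt_inverse : ContDiffAt ℝ 2 (fun u' ↦ (G u').inverse) u :=
  ContDiffAt.comp u (ContinuousLinearMap.IsInvertible.contDiffAt_map_inverse h.isInvertible)
    h.contDiffAt

lemma differentiableAt_christoffel (v w : E) :
    DifferentiableAt ℝ (fun u' ↦ christoffel G u' v w) u := by
  have hG : ContDiffAt ℝ 1 (fderiv ℝ G) u := h.contDiffAt.fderiv_right (by norm_num)
  have hG' := hG.differentiableAt (by norm_num)
  have h1 : ∀ v w : E, DifferentiableAt ℝ (fun u' ↦ fderiv ℝ G u' v w) u := fun v w ↦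
    (hG'.clm_apply (differentiableAt_const v)).clm_apply (differentiableAt_const w)
  have h2 : DifferentiableAt ℝ (fun u' ↦ ((fderiv ℝ G u').flip v).flip w) u := by
    -- The double flip is a fixed continuous linear operator, built from evaluations at `v` and `w`,
    -- applied to `fderiv ℝ G u'`. Its differentiability is then that of `fderiv ℝ G`.
    have : (fun u' ↦ ((fderiv ℝ G u').flip v).flip w) = fun u' ↦
      ContinuousLinearMap.compL ℝ E (E →L[ℝ] ℝ) ℝ (ContinuousLinearMap.apply ℝ ℝ w)
        (ContinuousLinearMap.compL ℝ E (E →L[ℝ] E →L[ℝ] ℝ) (E →L[ℝ] ℝ)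
          (ContinuousLinearMap.apply ℝ (E →L[ℝ] ℝ) v) (fderiv ℝ G u')) := by
      ext; simp
    rw [this]
    fun_prop
  exact (h.contDiffAt_inverse.differentiableAt (by norm_num)).clm_apply
    ((((h1 v w).fun_add (h1 w v)).fun_sub h2).fun_const_smul _)

variable {f : E → ℝ} (hf : ContDiffAt ℝ 2 f u)
include hf

lemma differentiableAt_grad : DifferentiableAt ℝ (grad G f) u :=
  (h.contDiffAt_inverse.differentiableAt (by norm_num)).clm_apply
    ((hf.fderiv_right (m := 1) (by norm_num)).differentiableAt (by norm_num))

/-- The Hessian is the covariant derivative of the gradient. -/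
lemma apply_covDeriv_grad (x y : E) :
    G u (fderiv ℝ (grad G f) u x + christoffel G u x (grad G f u)) y = hessian G f u x y := by
  -- The identity `G(grad f, y) = df(y)` is differentiated along `x`. Metric compatibility turns the
  -- derivative of `G` into Christoffel terms.
  have h1 : (fun u' ↦ G u' (grad G f u') y) =ᶠ[𝓝 u] fun u' ↦ fderiv ℝ f u' y :=
    h.eventually.mono fun u' hu' ↦ hu'.apply_grad f y
  have h2 := congrArg (fun A : E →L[ℝ] ℝ ↦ A x) h1.fderiv_eq
  rw [fderiv_clm_apply (h.differentiableAt.clm_apply (h.differentiableAt_grad hf))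
    (differentiableAt_const y), fderiv_clm_apply h.differentiableAt
    (h.differentiableAt_grad hf)] at h2
  simp only [fderiv_fun_const, Pi.zero_apply, ContinuousLinearMap.comp_zero, zero_add,
    ContinuousLinearMap.flip_apply, add_apply,
    ContinuousLinearMap.comp_apply, h.fderiv_eq] at h2
  rw [hessian, ← h2, covDeriv_const, ← h.apply_grad, map_add]
  simp only [add_apply]
  ring

end

end IsMetricAt

lemma hessian_eq (G : E → E →L[ℝ] E →L[ℝ] ℝ) (f : E → ℝ) (u x y : E) : hessian G f u x y =
    fderiv ℝ (fun u' ↦ fderiv ℝ f u' y) u x - fderiv ℝ f u (christoffel G u x y) := by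
  rw [hessian, covDeriv_const]

/-- Second derivatives commute and the connection is torsion-free. -/
lemma IsMetricAt.hessian_symm {G : E → E →L[ℝ] E →L[ℝ] ℝ} {u : E} (h : IsMetricAt G u)
    {f : E → ℝ} (hf : ContDiffAt ℝ 2 f u) (x y : E) : hessian G f u x y = hessian G f u y x := by
  have hf' := (hf.fderiv_right (m := 1) (by norm_num)).differentiableAt (by norm_num)
  have h1 := (hf.isSymmSndFDerivAt (by simp)).eq x y
  rw [hessian_eq, hessian_eq, h.christoffel_symm x y, fderiv_clm_apply hf'
    (differentiableAt_const y), fderiv_clm_apply hf' (differentiableAt_const x)]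
  simp [h1]

lemma laplacian_eq [FiniteDimensional ℝ E] (G : E → E →L[ℝ] E →L[ℝ] ℝ) (f : E → ℝ) (u : E) :
    laplacian G f u =
      traceMap fun e ↦ fderiv ℝ (grad G f) u e + christoffel G u e (grad G f u) := rfl

end ChartGeometry

/-! ### Christoffel symbols of `c² GB ⊕ w² GF`. -/

namespace ChartGeometry

variable {E : Type*} [NormedAddCommGroup E] [NormedSpace ℝ E]

/-- The difference of the Levi-Civita connections of `c² G` and `G`. -/
def conformalDiff (G : E → E →L[ℝ] E →L[ℝ] ℝ) (c : E → ℝ) (u x y : E) : E :=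
  (c u)⁻¹ • (fderiv ℝ c u x • y + fderiv ℝ c u y • x - G u x y • grad G c u)

variable {F : Type*} [NormedAddCommGroup F] [NormedSpace ℝ F]

/-- Near `z`, the metric `G` on an open subset of `E × F` is `c² GB ⊕ w² GF`, where `c` and `w` are
functions of the first variable. -/
structure IsWarpedAt (GB : E → E →L[ℝ] E →L[ℝ] ℝ) (GF : F → F →L[ℝ] F →L[ℝ] ℝ) (c w : E → ℝ)
    (G : E × F → E × F →L[ℝ] E × F →L[ℝ] ℝ) (z : E × F) : Prop where
  base : IsMetricAt GB z.1
  fiber : IsMetricAt GF z.2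
  total : IsMetricAt G z
  contDiffAt_conf : ContDiffAt ℝ 2 c z.1
  contDiffAt_warp : ContDiffAt ℝ 2 w z.1
  conf_ne : c z.1 ≠ 0
  warp_ne : w z.1 ≠ 0
  eq : ∀ᶠ z' in 𝓝 z, ∀ a b : E × F,
    G z' a b = c z'.1 ^ 2 * GB z'.1 a.1 b.1 + w z'.1 ^ 2 * GF z'.2 a.2 b.2

namespace IsWarpedAt

variable {GB : E → E →L[ℝ] E →L[ℝ] ℝ} {GF : F → F →L[ℝ] F →L[ℝ] ℝ} {c w : E → ℝ}
  {G : E × F → E × F →L[ℝ] E × F →L[ℝ] ℝ} {z : E × F} (h : IsWarpedAt GB GF c w G z)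
include h

/-- Every condition is open, so the formula for the Christoffel symbols holds on a neighbourhood and
may be differentiated. -/
lemma eventually [CompleteSpace E] [CompleteSpace F] :
    ∀ᶠ z' in 𝓝 z, IsWarpedAt GB GF c w G z' := by
  have hfst : Filter.Tendsto Prod.fst (𝓝 z) (𝓝 z.1) := continuous_fst.continuousAt
  have hsnd : Filter.Tendsto Prod.snd (𝓝 z) (𝓝 z.2) := continuous_snd.continuousAt
  filter_upwards [hfst.eventually h.base.eventually, hsnd.eventually h.fiber.eventually,
    h.total.eventually, hfst.eventually (h.contDiffAt_conf.eventually (by norm_num)),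
    hfst.eventually (h.contDiffAt_warp.eventually (by norm_num)),
    hfst.eventually (h.contDiffAt_conf.continuousAt.eventually_ne h.conf_ne),
    hfst.eventually (h.contDiffAt_warp.continuousAt.eventually_ne h.warp_ne),
    h.eq.eventually_nhds] with z' h1 h2 h3 h4 h5 h6 h7 h8 using ⟨h1, h2, h3, h4, h5, h6, h7, h8⟩

lemma hasFDerivAt_conf : HasFDerivAt c (fderiv ℝ c z.1) z.1 :=
  (h.contDiffAt_conf.differentiableAt (by norm_num)).hasFDerivAt

lemma hasFDerivAt_warp : HasFDerivAt w (fderiv ℝ w z.1) z.1 :=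
  (h.contDiffAt_warp.differentiableAt (by norm_num)).hasFDerivAt

lemma fderiv_total (d a b : E × F) : fderiv ℝ G z d a b =
    2 * c z.1 * fderiv ℝ c z.1 d.1 * GB z.1 a.1 b.1 + c z.1 ^ 2 * fderiv ℝ GB z.1 d.1 a.1 b.1
    + (2 * w z.1 * fderiv ℝ w z.1 d.1 * GF z.2 a.2 b.2
      + w z.1 ^ 2 * fderiv ℝ GF z.2 d.2 a.2 b.2) := by
  have hfst : HasFDerivAt Prod.fst (ContinuousLinearMap.fst ℝ E F) z := hasFDerivAt_fst
  have hsnd : HasFDerivAt Prod.snd (ContinuousLinearMap.snd ℝ E F) z := hasFDerivAt_snd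
  have h1 := ((h.hasFDerivAt_conf.comp z hfst).pow 2).mul
    ((h.base.differentiableAt_apply a.1 b.1).hasFDerivAt.comp z hfst)
  have h2 := ((h.hasFDerivAt_warp.comp z hfst).pow 2).mul
    ((h.fiber.differentiableAt_apply a.2 b.2).hasFDerivAt.comp z hsnd)
  have h3 := (h1.add h2).congr_of_eventuallyEq (f₁ := fun z' ↦ G z' a b)
    (h.eq.mono fun z' hz' ↦ hz' a b)
  rw [← h.total.fderiv_apply, h3.fderiv]
  simp [h.base.fderiv_apply, h.fiber.fderiv_apply]
  ring

/-- The Christoffel symbols of a base conformal warped product. -/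
lemma christoffel_eq (a b : E × F) : christoffel G z a b =
    (christoffel GB z.1 a.1 b.1 + conformalDiff GB c z.1 a.1 b.1
        + GF z.2 a.2 b.2 • (-(w z.1 / c z.1 ^ 2)) • grad GB w z.1,
      christoffel GF z.2 a.2 b.2 + (fderiv ℝ w z.1 a.1 / w z.1) • b.2
        + (fderiv ℝ w z.1 b.1 / w z.1) • a.2) := by
  have hc := h.conf_ne
  have hw := h.warp_ne
  -- The right-hand side is checked against the Koszul formula, after pairing with an arbitrary `d`.
  -- The factor `-(w/c²)` arises from `-w dw(d) GF`, since the base part of `G` carries `c²`.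
  refine h.total.ext fun d ↦ ?_
  rw [h.total.apply_christoffel, h.eq.self_of_nhds, h.fderiv_total, h.fderiv_total, h.fderiv_total]
  simp only [map_add, add_apply, map_smul, smul_apply, smul_eq_mul, conformalDiff, map_sub,
    sub_apply, h.base.apply_christoffel, h.fiber.apply_christoffel, h.base.apply_grad]
  field_simp
  ring

end IsWarpedAt

end ChartGeometry

/-! ### Curvature and Ricci tensor under a conformal change of the base metric. -/

namespace ChartGeometry

variable {E : Type*} [NormedAddCommGroup E] [NormedSpace ℝ E]

lemma christoffel_sub_right (G : E → E →L[ℝ] E →L[ℝ] ℝ) (u v w w' : E) :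
    christoffel G u v (w - w') = christoffel G u v w - christoffel G u v w' := by
  rw [sub_eq_add_neg, ← neg_one_smul ℝ w', christoffel_add_right, christoffel_smul_right]
  module

lemma conformalDiff_zero_left (G : E → E →L[ℝ] E →L[ℝ] ℝ) (c : E → ℝ) (u y : E) :
    conformalDiff G c u 0 y = 0 := by
  simp [conformalDiff]

lemma conformalDiff_zero_right (G : E → E →L[ℝ] E →L[ℝ] ℝ) (c : E → ℝ) (u x : E) :
    conformalDiff G c u x 0 = 0 := by
  simp [conformalDiff]

/-- Trades second partial derivatives for the Hessian, a tensor. The Christoffel terms left over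
cancel in the curvature. -/
lemma fderiv_fderiv_apply (G : E → E →L[ℝ] E →L[ℝ] ℝ) (f : E → ℝ) (u x y : E) :
    fderiv ℝ (fun u' ↦ fderiv ℝ f u' y) u x =
      hessian G f u x y + fderiv ℝ f u (christoffel G u x y) := by
  rw [hessian_eq, sub_add_cancel]

lemma isLinearMap_hessian (G : E → E →L[ℝ] E →L[ℝ] ℝ) (f : E → ℝ) (u y : E) :
    IsLinearMap ℝ fun x ↦ hessian G f u x y where
  map_add x x' := by
    simp only [hessian_eq, christoffel_add_left, map_add]
    ring
  map_smul r x := by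
    simp only [hessian_eq, christoffel_smul_left, map_smul, smul_eq_mul]
    ring

section Trace

variable [FiniteDimensional ℝ E]

lemma traceMap_smul_id (r : ℝ) : traceMap (fun e : E ↦ r • e) = r * Module.finrank ℝ E := by
  rw [traceMap_smul, traceMap_id]

lemma traceMap_hessian_smul (G : E → E →L[ℝ] E →L[ℝ] ℝ) (f : E → ℝ) (u y v : E) :
    traceMap (fun e ↦ hessian G f u e y • v) = hessian G f u v y :=
  traceMap_smulRight (LinearMap.toContinuousLinearMap (isLinearMap_hessian G f u y).mk') v

end Trace

namespace IsMetricAt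

variable {G : E → E →L[ℝ] E →L[ℝ] ℝ} {u : E} (h : IsMetricAt G u)
include h

/-- The curvature, as a linear map of its first argument. -/
def curvatureLinearMap [CompleteSpace E] (x y : E) : E →ₗ[ℝ] E where
  toFun e := curvature G (fun _ ↦ e) (fun _ ↦ y) (fun _ ↦ x) u
  map_add' e e' := by
    simp only [curvature_const, christoffel_add_left, map_add, christoffel_add_right]
    rw [fderiv_fun_add (h.differentiableAt_christoffel e x) (h.differentiableAt_christoffel e' x)]
    simp only [add_apply]
    abel
  map_smul' r e := by
    simp only [curvature_const, christoffel_smul_left, map_smul, christoffel_smul_right,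
      RingHom.id_apply]
    rw [fderiv_fun_const_smul (h.differentiableAt_christoffel e x)]
    simp only [smul_apply]
    module

variable {c : E → ℝ} (hc : ContDiffAt ℝ 2 c u) (hc0 : c u ≠ 0)
include hc

/-- The covariant derivative of the gradient is symmetric. -/
lemma apply_covDeriv_grad' [CompleteSpace E] (x y : E) :
    G u y (fderiv ℝ (grad G c) u x + christoffel G u x (grad G c u)) = hessian G c u x y := by
  rw [h.apply_symm, h.apply_covDeriv_grad hc]

include hc0

variable [CompleteSpace E]

lemma differentiableAt_conformalDiff (x y : E) :
    DifferentiableAt ℝ (fun u' ↦ conformalDiff G c u' x y) u := by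
  have h1 := hc.differentiableAt (by norm_num)
  have h2 := differentiableAt_fderiv_apply hc
  exact (h1.inv hc0).smul ((((h2 x).smul_const y).add ((h2 y).smul_const x)).sub
    ((h.differentiableAt_apply x y).smul (h.differentiableAt_grad hc)))

lemma fderiv_conformalDiff (x y e : E) :
    fderiv ℝ (fun u' ↦ conformalDiff G c u' x y) u e =
      (c u)⁻¹ • ((hessian G c u e x + fderiv ℝ c u (christoffel G u e x)) • y
        + (hessian G c u e y + fderiv ℝ c u (christoffel G u e y)) • x
        - ((G u (christoffel G u e x) y + G u x (christoffel G u e y)) • grad G c u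
          + G u x y • fderiv ℝ (grad G c) u e))
      - (fderiv ℝ c u e / c u ^ 2) •
        (fderiv ℝ c u x • y + fderiv ℝ c u y • x - G u x y • grad G c u) := by
  have h1 := (hc.differentiableAt (by norm_num)).hasFDerivAt
  have h2 := fun y ↦ (differentiableAt_fderiv_apply hc y).hasFDerivAt
  have h3 := (((hasDerivAt_inv hc0).comp_hasFDerivAt u h1)).smul
    ((((h2 x).smul_const y).add ((h2 y).smul_const x)).sub
    ((h.differentiableAt_apply x y).hasFDerivAt.smul (h.differentiableAt_grad hc).hasFDerivAt))
  have h4 : HasFDerivAt (fun u' ↦ conformalDiff G c u' x y) _ u := h3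
  rw [h4.fderiv]
  simp [h.fderiv_apply, h.fderiv_eq, fderiv_fderiv_apply G]
  module

/-- The curvature of `c² G`. -/
lemma curvature_conformal (x y e : E) :
    fderiv ℝ (fun u' ↦ christoffel G u' y x) u e
      + fderiv ℝ (fun u' ↦ conformalDiff G c u' y x) u e
      + (christoffel G u e (christoffel G u y x + conformalDiff G c u y x)
        + conformalDiff G c u e (christoffel G u y x + conformalDiff G c u y x))
      - (fderiv ℝ (fun u' ↦ christoffel G u' e x) u y
        + fderiv ℝ (fun u' ↦ conformalDiff G c u' e x) u y
        + (christoffel G u y (christoffel G u e x + conformalDiff G c u e x)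
          + conformalDiff G c u y (christoffel G u e x + conformalDiff G c u e x))) =
    curvature G (fun _ ↦ e) (fun _ ↦ y) (fun _ ↦ x) u
      + (c u)⁻¹ • (hessian G c u e x • y
        - G u x y • (fderiv ℝ (grad G c) u e + christoffel G u e (grad G c u))
        - hessian G c u y x • e
        + G u x e • (fderiv ℝ (grad G c) u y + christoffel G u y (grad G c u)))
      + (1 / c u ^ 2) • ((2 * G u x y) • (fderiv ℝ c u e • grad G c u)
        - (2 * fderiv ℝ c u x) • (fderiv ℝ c u e • y)
        + (2 * fderiv ℝ c u x * fderiv ℝ c u y) • e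
        - (2 * fderiv ℝ c u y) • (G u x e • grad G c u)
        - (G u x y * G u (grad G c u) (grad G c u)) • e
        + G u (grad G c u) (grad G c u) • (G u x e • y)) := by
  -- The left side is the curvature of the connection `∇ + D` with `D = conformalDiff`: that of `∇`,
  -- plus the antisymmetrised `∇D`, plus the commutator of `D` with itself. All derivatives of `c`
  -- are written as pairings with its gradient and the symmetries bring the scalars to a common
  -- form, so that only linear algebra remains.
  rw [curvature_const, h.fderiv_conformalDiff hc hc0, h.fderiv_conformalDiff hc hc0]
  simp only [conformalDiff, christoffel_add_right, christoffel_sub_right, christoffel_smul_right,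
    map_add, map_sub, map_smul, smul_eq_mul, ← h.apply_grad c]
  rw [h.christoffel_symm y e, h.hessian_symm hc y e, h.apply_symm y x, h.apply_symm e x,
    h.apply_symm e y, h.apply_symm e (grad G c u), h.apply_symm y (grad G c u),
    h.apply_symm _ x, h.apply_symm _ x, h.apply_symm e (christoffel G u y x),
    h.apply_symm y (christoffel G u e x)]
  module

/-- Each multiple of the identity counts `m` and each rank-one term counts once. The Hessian
receives `1 + 1 - m`, the product `dc(x) dc(y)` receives `2m - 2 - 2`, and `|∇c|² G(x, y)` receives
`2 + 1 - m`. -/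
lemma ricci_conformal [FiniteDimensional ℝ E] (x y : E) :
    (traceMap fun e ↦ fderiv ℝ (fun u' ↦ christoffel G u' y x) u e
      + fderiv ℝ (fun u' ↦ conformalDiff G c u' y x) u e
      + (christoffel G u e (christoffel G u y x + conformalDiff G c u y x)
        + conformalDiff G c u e (christoffel G u y x + conformalDiff G c u y x))
      - (fderiv ℝ (fun u' ↦ christoffel G u' e x) u y
        + fderiv ℝ (fun u' ↦ conformalDiff G c u' e x) u y
        + (christoffel G u y (christoffel G u e x + conformalDiff G c u e x)
          + conformalDiff G c u y (christoffel G u e x + conformalDiff G c u e x)))) =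
    ricci G u x y - ((Module.finrank ℝ E : ℝ) - 2) * (1 / c u) * hessian G c u x y
      + 2 * ((Module.finrank ℝ E : ℝ) - 2) * (1 / c u ^ 2) * (fderiv ℝ c u x * fderiv ℝ c u y)
      - (((Module.finrank ℝ E : ℝ) - 3) * (G u (grad G c u) (grad G c u) / c u ^ 2)
        + laplacian G c u / c u) * G u x y := by
  simp only [h.curvature_conformal hc hc0, traceMap_add, traceMap_sub, traceMap_smul_id,
    traceMap_smul, traceMap_smulRight, traceMap_hessian_smul]
  rw [← traceMap_add, ← laplacian_eq, h.apply_covDeriv_grad' hc, h.apply_symm x (grad G c u),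
    h.apply_grad, h.apply_grad, h.hessian_symm hc y x, ← ricci]
  ring

end IsMetricAt

end ChartGeometry

/-! ### Ricci tensor of the warped metric in coordinates. -/

namespace ChartGeometry

variable {E : Type*} [NormedAddCommGroup E] [NormedSpace ℝ E]
  {F : Type*} [NormedAddCommGroup F] [NormedSpace ℝ F]

namespace IsWarpedAt

variable {GB : E → E →L[ℝ] E →L[ℝ] ℝ} {GF : F → F →L[ℝ] F →L[ℝ] ℝ} {c w : E → ℝ}
  {G : E × F → E × F →L[ℝ] E × F →L[ℝ] ℝ} {z : E × F} (h : IsWarpedAt GB GF c w G z)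
include h

lemma fderiv_warp_div (x e : E) : fderiv ℝ (fun u ↦ fderiv ℝ w u x / w u) z.1 e =
    (hessian GB w z.1 e x + fderiv ℝ w z.1 (christoffel GB z.1 e x)) / w z.1
      - fderiv ℝ w z.1 x * fderiv ℝ w z.1 e / w z.1 ^ 2 := by
  have h1 := (((hasDerivAt_inv h.warp_ne).comp_hasFDerivAt z.1 h.hasFDerivAt_warp))
  have h2 : HasFDerivAt (fun u ↦ fderiv ℝ w u x / w u) _ z.1 :=
    (differentiableAt_fderiv_apply h.contDiffAt_warp x).hasFDerivAt.mul h1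
  rw [h2.fderiv]
  simp [fderiv_fderiv_apply GB]
  ring

lemma differentiableAt_warp_div (x : E) :
    DifferentiableAt ℝ (fun u ↦ fderiv ℝ w u x / w u) z.1 :=
  (differentiableAt_fderiv_apply h.contDiffAt_warp x).mul
    (h.hasFDerivAt_warp.differentiableAt.inv h.warp_ne)

variable [CompleteSpace E]

lemma differentiableAt_warp_grad :
    DifferentiableAt ℝ (fun u ↦ (-(w u / c u ^ 2)) • grad GB w u) z.1 :=
  (h.hasFDerivAt_warp.differentiableAt.mul
    ((h.hasFDerivAt_conf.differentiableAt.pow 2).inv (pow_ne_zero 2 h.conf_ne))).neg.smul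
    (h.base.differentiableAt_grad h.contDiffAt_warp)

lemma fderiv_warp_grad (e : E) :
    fderiv ℝ (fun u ↦ (-(w u / c u ^ 2)) • grad GB w u) z.1 e =
      (-(w z.1 / c z.1 ^ 2)) • fderiv ℝ (grad GB w) z.1 e
      - (1 / c z.1 ^ 2) • (fderiv ℝ w z.1 e • grad GB w z.1)
      + (2 * w z.1 / c z.1 ^ 3) • (fderiv ℝ c z.1 e • grad GB w z.1) := by
  have hc := h.conf_ne
  have h1 := (hasDerivAt_inv (pow_ne_zero 2 h.conf_ne)).comp_hasFDerivAt z.1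
    (h.hasFDerivAt_conf.pow 2)
  have h2 : HasFDerivAt (fun u ↦ (-(w u / c u ^ 2)) • grad GB w u) _ z.1 :=
    (h.hasFDerivAt_warp.mul h1).neg.smul
      (h.base.differentiableAt_grad h.contDiffAt_warp).hasFDerivAt
  rw [h2.fderiv]
  simp
  match_scalars <;> field_simp

variable [CompleteSpace F]

lemma fderiv_christoffel (a b d : E × F) : fderiv ℝ (fun z' ↦ christoffel G z' a b) z d =
    (fderiv ℝ (fun u ↦ christoffel GB u a.1 b.1) z.1 d.1
      + fderiv ℝ (fun u ↦ conformalDiff GB c u a.1 b.1) z.1 d.1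
      + (GF z.2 a.2 b.2 • fderiv ℝ (fun u ↦ (-(w u / c u ^ 2)) • grad GB w u) z.1 d.1
        + fderiv ℝ GF z.2 d.2 a.2 b.2 • (-(w z.1 / c z.1 ^ 2)) • grad GB w z.1),
      fderiv ℝ (fun v ↦ christoffel GF v a.2 b.2) z.2 d.2
      + fderiv ℝ (fun u ↦ fderiv ℝ w u a.1 / w u) z.1 d.1 • b.2
      + fderiv ℝ (fun u ↦ fderiv ℝ w u b.1 / w u) z.1 d.1 • a.2) := by
  have hfst : HasFDerivAt Prod.fst (ContinuousLinearMap.fst ℝ E F) z := hasFDerivAt_fst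
  have hsnd : HasFDerivAt Prod.snd (ContinuousLinearMap.snd ℝ E F) z := hasFDerivAt_snd
  have h1 := (h.base.differentiableAt_christoffel a.1 b.1).hasFDerivAt.comp z hfst
  have h2 := (h.base.differentiableAt_conformalDiff h.contDiffAt_conf h.conf_ne
    a.1 b.1).hasFDerivAt.comp z hfst
  have h3 := ((h.fiber.differentiableAt_apply a.2 b.2).hasFDerivAt.comp z hsnd).smul
    (h.differentiableAt_warp_grad.hasFDerivAt.comp z hfst)
  have h4 := (h.fiber.differentiableAt_christoffel a.2 b.2).hasFDerivAt.comp z hsnd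
  have h5 := fun x ↦ (h.differentiableAt_warp_div x).hasFDerivAt.comp z hfst
  -- `christoffel_eq` holds at all nearby points, so its right-hand side is differentiated term by
  -- term.
  have h6 := (((h1.add h2).add h3).prodMk
    ((h4.add ((h5 a.1).smul_const b.2)).add ((h5 b.1).smul_const a.2))).congr_of_eventuallyEq
    (f₁ := fun z' ↦ christoffel G z' a b) (h.eventually.mono fun z' hz' ↦ hz'.christoffel_eq a b)
  rw [h6.fderiv]
  simp [h.fiber.fderiv_apply]

variable [FiniteDimensional ℝ E] [FiniteDimensional ℝ F]

/-- The block formula for the trace needs a linear map, which is the purpose of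
`curvatureLinearMap`. -/
lemma ricci_eq_add (a b : E × F) : ricci G z a b =
    traceMap (fun e : E ↦ (curvature G (fun _ ↦ (e, 0)) (fun _ ↦ b) (fun _ ↦ a) z).1)
    + traceMap (fun f : F ↦ (curvature G (fun _ ↦ (0, f)) (fun _ ↦ b) (fun _ ↦ a) z).2) :=
  traceMap_prod (h.total.curvatureLinearMap a b)

/-- The base block vanishes identically. In the fibre block the two terms `(dw(x)/w) Γ_F(f, b)` and
`(dw(x)/w) Γ_F(b, f)` cancel by symmetry. -/
lemma ricci_base_fiber (x : E) (b : F) : ricci G z (x, 0) (0, b) = 0 := by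
  rw [h.ricci_eq_add]
  simp only [curvature_const, h.fderiv_christoffel, h.christoffel_eq]
  simp [christoffel_zero_left, christoffel_zero_right, conformalDiff_zero_left,
    conformalDiff_zero_right, traceMap, christoffel_smul_left, christoffel_smul_right,
    h.fiber.christoffel_symm b]

lemma ricci_fiber_base (x : E) (b : F) : ricci G z (0, b) (x, 0) = 0 := by
  rw [h.ricci_eq_add]
  simp only [curvature_const, h.fderiv_christoffel, h.christoffel_eq]
  simp [christoffel_zero_left, christoffel_zero_right, conformalDiff_zero_right, traceMap,
    christoffel_smul_right]

lemma ricci_base (x y : E) : ricci G z (x, 0) (y, 0) =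
    ricci GB z.1 x y
      - ((Module.finrank ℝ E : ℝ) - 2) * (1 / c z.1) * hessian GB c z.1 x y
      + 2 * ((Module.finrank ℝ E : ℝ) - 2) * (1 / c z.1 ^ 2)
        * (fderiv ℝ c z.1 x * fderiv ℝ c z.1 y)
      - (((Module.finrank ℝ E : ℝ) - 3)
          * (GB z.1 (grad GB c z.1) (grad GB c z.1) / c z.1 ^ 2)
        + laplacian GB c z.1 / c z.1) * GB z.1 x y
      - (Module.finrank ℝ F : ℝ) * (1 / w z.1) * hessian GB w z.1 x y
      - (Module.finrank ℝ F : ℝ) * (GB z.1 (grad GB w z.1) (grad GB c z.1) / (w z.1 * c z.1))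
        * GB z.1 x y
      + (Module.finrank ℝ F : ℝ) * (fderiv ℝ c z.1 x / c z.1) * (fderiv ℝ w z.1 y / w z.1)
      + (Module.finrank ℝ F : ℝ) * (fderiv ℝ c z.1 y / c z.1) * (fderiv ℝ w z.1 x / w z.1) := by
  -- The fibre block is scalar: minus the Hessian of `w` for `c² GB`, divided by `w`. Expanding
  -- `dw(conformalDiff)` yields the terms of the result that mix `c` and `w`.
  have h1 : ∀ f : F, ((fderiv ℝ w z.1 (christoffel GB z.1 y x)
      + fderiv ℝ w z.1 (conformalDiff GB c z.1 y x)) / w z.1) • f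
      - (fderiv ℝ (fun u ↦ fderiv ℝ w u x / w u) z.1 y • f
        + (fderiv ℝ w z.1 y / w z.1) • (fderiv ℝ w z.1 x / w z.1) • f) =
      (fderiv ℝ w z.1 (conformalDiff GB c z.1 y x) / w z.1 - hessian GB w z.1 x y / w z.1) • f := by
    intro f
    rw [h.fderiv_warp_div, h.base.hessian_symm h.contDiffAt_warp x y]
    module
  rw [h.ricci_eq_add]
  simp only [curvature_const, h.fderiv_christoffel, h.christoffel_eq]
  simp only [christoffel_zero_left, christoffel_zero_right, conformalDiff_zero_left,
    conformalDiff_zero_right, map_zero, zero_apply, zero_smul, smul_zero, zero_div, add_zero,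
    zero_add, map_add, fderiv_fun_const, Pi.zero_apply, Prod.fst_add,
    Prod.snd_add, Prod.fst_sub, Prod.snd_sub, h1]
  rw [h.base.ricci_conformal h.contDiffAt_conf h.conf_ne, traceMap_smul_id, conformalDiff]
  simp only [map_sub, map_add, map_smul, smul_eq_mul, h.base.apply_grad, h.base.apply_symm y x,
    h.base.fderiv_grad_symm w c]
  field_simp
  ring

lemma ricci_fiber (a b : F) : ricci G z (0, a) (0, b) =
    ricci GF z.2 a b - (w z.1 ^ 2 / c z.1 ^ 2) * GF z.2 a b *
      (((Module.finrank ℝ E : ℝ) - 2)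
          * (GB z.1 (grad GB w z.1) (grad GB c z.1) / (w z.1 * c z.1))
        + laplacian GB w z.1 / w z.1
        + ((Module.finrank ℝ F : ℝ) - 1)
          * (GB z.1 (grad GB w z.1) (grad GB w z.1) / w z.1 ^ 2)) := by
  have hc := h.conf_ne
  have hw := h.warp_ne
  rw [h.ricci_eq_add]
  simp only [curvature_const, h.fderiv_christoffel, h.christoffel_eq, h.fderiv_warp_grad]
  simp only [christoffel_zero_left, christoffel_zero_right, conformalDiff_zero_left,
    conformalDiff_zero_right, map_zero, zero_apply, zero_smul, smul_zero, zero_div, add_zero,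
    zero_add, fderiv_fun_const, Pi.zero_apply, Prod.fst_add, Prod.snd_add, Prod.fst_sub,
    Prod.snd_sub]
  -- In the base block, differentiating `c⁻²` gives `2 dc(e) ∇w` and `conformalDiff` takes one copy
  -- away. The trace is then `1 - m + 1`, which is the coefficient `-(m - 2)`. In the fibre block
  -- the two `|∇w|²` terms contribute `-k + 1`.
  trans (traceMap fun e ↦ (-(GF z.2 a b * w z.1 / c z.1 ^ 2)) •
      (fderiv ℝ (grad GB w) z.1 e + christoffel GB z.1 e (grad GB w z.1))
      + (GF z.2 a b * w z.1 / c z.1 ^ 3) • (fderiv ℝ c z.1 e • grad GB w z.1)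
      - (GF z.2 a b * w z.1 * fderiv ℝ c z.1 (grad GB w z.1) / c z.1 ^ 3) • e
      + (GF z.2 a b * w z.1 / c z.1 ^ 3) • (GB z.1 (grad GB w z.1) e • grad GB c z.1))
    + (traceMap fun f ↦ curvature GF (fun _ ↦ f) (fun _ ↦ b) (fun _ ↦ a) z.2
      - (GF z.2 a b * fderiv ℝ w z.1 (grad GB w z.1) / c z.1 ^ 2) • f
      + (fderiv ℝ w z.1 (grad GB w z.1) / c z.1 ^ 2) • (GF z.2 a f • b))
  · refine congrArg₂ _ (congrArg traceMap (funext fun e ↦ ?_))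
      (congrArg traceMap (funext fun f ↦ ?_))
    · simp only [conformalDiff, christoffel_smul_right, map_smul, smul_apply, smul_eq_mul,
        h.fiber.apply_symm b a, h.base.apply_symm e]
      match_scalars <;> field_simp
      ring
    · simp only [curvature_const, map_smul, smul_eq_mul, h.fiber.apply_symm b a,
        h.fiber.apply_symm f a]
      match_scalars <;> field_simp
  · simp only [traceMap_add, traceMap_sub, traceMap_smul_id, traceMap_smul, traceMap_smulRight]
    rw [← traceMap_add, ← laplacian_eq, ← ricci, ← h.base.apply_grad, ← h.base.apply_grad,
      h.base.apply_symm (grad GB c z.1)]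
    field_simp
    ring

end IsWarpedAt

end ChartGeometry

/-! ### Passage from the manifold to the preferred chart. -/

open ChartGeometry

section Manifold

variable {E : Type*} [NormedAddCommGroup E] [NormedSpace ℝ E]
  {H : Type*} [TopologicalSpace H] {I : ModelWithCorners ℝ E H}
  {M : Type*} [TopologicalSpace M] [ChartedSpace H M] [IsManifold I ∞ M]

/-- The derivative of the inverse of the preferred chart is the identity at the centre. -/
lemma mfderivWithin_extChartAt_symm_center (x : M) :
    mfderivWithin 𝓘(ℝ, E) I (extChartAt I x).symm (Set.range I) (extChartAt I x x) =
      ContinuousLinearMap.id ℝ E := by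
  have h := TangentBundle.symmL_trivializationAt (I := I) (mem_chart_source H x)
  rw [← h, TangentBundle.symmL_trivializationAt_eq_core (mem_chart_source H x)]
  ext v
  exact (tangentBundleCore I M).coordChange_self (achart H x) x (mem_chart_source H x) v

variable [I.Boundaryless]

omit [IsManifold I ∞ M] in
lemma ContMDiff.contDiffAt_comp_extChartAt_symm {f : M → ℝ} (hf : ContMDiff I 𝓘(ℝ) ∞ f) (x : M) :
    ContDiffAt ℝ ∞ (f ∘ (extChartAt I x).symm) (extChartAt I x x) := by
  have h1 := (contMDiffAt_iff.1 (hf x)).2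
  rw [I.range_eq_univ, contDiffWithinAt_univ] at h1
  exact h1

omit [IsManifold I ∞ M] in
lemma fderiv_comp_extChartAt_symm {f : M → ℝ} (hf : ContMDiff I 𝓘(ℝ) ∞ f) (x : M) :
    fderiv ℝ (f ∘ (extChartAt I x).symm) (extChartAt I x x) = mvfderiv I f x := by
  ext v
  have h := (hf x).mdifferentiableAt (by norm_num)
  have h2 : mfderiv I 𝓘(ℝ) f x = fderiv ℝ (f ∘ (extChartAt I x).symm) (extChartAt I x x) := by
    rw [h.mfderiv, I.range_eq_univ, fderivWithin_univ]
    rfl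
  exact congrArg (fun A : E →L[ℝ] ℝ ↦ A v) h2.symm

namespace PseudoRiemannianMetric

variable (g : PseudoRiemannianMetric I M)

omit [I.Boundaryless] in
lemma inChart_center (x : M) : g.inChart x (extChartAt I x x) = g.val x := by
  -- The type of `g.val y` depends on `y`, so the base point and the derivative are generalised
  -- before being replaced.
  have h : ∀ D : E →L[ℝ] E, D = ContinuousLinearMap.id ℝ E → ∀ y : M, y = x →
      ∀ v w : E, g.val y (D v) (D w) = g.val x v w := by
    rintro _ rfl _ rfl v w
    rfl
  ext v w
  exact h _ (mfderivWithin_extChartAt_symm_center x) _ (extChartAt_to_inv x) v w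

lemma contDiffAt_inChart (x : M) : ContDiffAt ℝ ∞ (g.inChart x) (extChartAt I x x) := by
  have h1 := (contMDiffAt_bilinForm_iff g.val x).1 (g.contMDiff x)
  have ht := (isOpen_extChartAt_target (I := I) x).mem_nhds (mem_extChartAt_target x)
  have h2 := (contMDiffOn_extChartAt_symm (I := I) (n := ∞) x).contMDiffAt ht
  have h4 := contMDiffAt_iff_contDiffAt.1 (h1.comp_of_eq h2 (extChartAt_to_inv x))
  refine h4.congr_of_eventuallyEq ?_
  filter_upwards [ht] with u hu
  -- The smoothness criterion evaluates the chart derivative at the image of the point `(extChartAt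
  -- I x).symm u`, whereas `inChart` evaluates it at `u`. The two agree on the chart target.
  have h3 : ∀ u', u' = u → g.inChart x u =
      letI D : E →L[ℝ] E := mfderivWithin 𝓘(ℝ, E) I (extChartAt I x).symm (Set.range I) u'
      ((ContinuousLinearMap.precomp ℝ D) ∘L (g.val ((extChartAt I x).symm u)) ∘L D :
        E →L[ℝ] E →L[ℝ] ℝ) := by
    rintro _ rfl
    rfl
  exact h3 _ ((extChartAt I x).right_inv hu)

lemma isMetricAt_inChart [FiniteDimensional ℝ E] (x : M) :
    IsMetricAt (g.inChart x) (extChartAt I x x) where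
  contDiffAt := (g.contDiffAt_inChart x).of_le ENat.LEInfty.out
  symm := Filter.Eventually.of_forall fun u v w ↦ g.symm _ _ _
  isInvertible := by
    rw [g.inChart_center]
    let A : E →ₗ[ℝ] E →L[ℝ] ℝ := (g.val x : E →L[ℝ] E →L[ℝ] ℝ).toLinearMap
    -- Nondegeneracy is injectivity into the dual, which has the same finite dimension; hence the
    -- metric is an isomorphism.
    have hA : Function.Injective A := (injective_iff_map_eq_zero A).2 fun v hv ↦
      g.nondegenerate x v fun w ↦ congrArg (fun B : E →L[ℝ] ℝ ↦ B w) hv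
    have hd : Module.finrank ℝ E = Module.finrank ℝ (E →L[ℝ] ℝ) :=
      Subspace.dual_finrank_eq.symm.trans LinearMap.toContinuousLinearMap.finrank_eq
    refine ⟨(LinearEquiv.ofInjectiveOfFinrankEq A hA hd).toContinuousLinearEquiv, ?_⟩
    ext v w
    rfl

lemma grad_inChart {f : M → ℝ} (hf : ContMDiff I 𝓘(ℝ) ∞ f) (x : M) :
    ChartGeometry.grad (g.inChart x) (f ∘ (extChartAt I x).symm) (extChartAt I x x) =
      g.grad f x := by
  rw [ChartGeometry.grad, g.inChart_center, fderiv_comp_extChartAt_symm hf]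
  rfl

end PseudoRiemannianMetric

end Manifold

/-! ### The warped product in the product chart. -/

section Warped

variable {EB : Type*} [NormedAddCommGroup EB] [NormedSpace ℝ EB] [FiniteDimensional ℝ EB]
  {HB : Type*} [TopologicalSpace HB] {IB : ModelWithCorners ℝ EB HB} [IB.Boundaryless]
  {B : Type*} [TopologicalSpace B] [ChartedSpace HB B] [IsManifold IB ∞ B]
  {EF : Type*} [NormedAddCommGroup EF] [NormedSpace ℝ EF] [FiniteDimensional ℝ EF]
  {HF : Type*} [TopologicalSpace HF] {IF : ModelWithCorners ℝ EF HF} [IF.Boundaryless]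
  {F : Type*} [TopologicalSpace F] [ChartedSpace HF F] [IsManifold IF ∞ F]
  (gB : PseudoRiemannianMetric IB B) (gF : PseudoRiemannianMetric IF F)
  (c w : B → ℝ) (hc : ContMDiff IB 𝓘(ℝ) ∞ c) (hw : ContMDiff IB 𝓘(ℝ) ∞ w)
  (hc0 : ∀ p, 0 < c p) (hw0 : ∀ p, 0 < w p) (p : B) (q : F)

omit [FiniteDimensional ℝ EB] [IB.Boundaryless] [IsManifold IB ∞ B]
  [FiniteDimensional ℝ EF] [IF.Boundaryless] [IsManifold IF ∞ F] in
lemma liftBase_eq (X : TangentSpace IB p) :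
    liftBase (IF := IF) p q X = ((X, 0) : EB × EF) := by
  rw [liftBase, mfderiv_prod_left]
  rfl

omit [FiniteDimensional ℝ EB] [IB.Boundaryless] [IsManifold IB ∞ B]
  [FiniteDimensional ℝ EF] [IF.Boundaryless] [IsManifold IF ∞ F] in
lemma liftFiber_eq (V : TangentSpace IF q) :
    liftFiber (IB := IB) p q V = ((0, V) : EB × EF) := by
  rw [liftFiber, mfderiv_prod_right]
  rfl

/-- The inverse product chart has block diagonal derivative, so pulling back preserves the
splitting. This holds on the product of the two chart targets, which is open because the manifolds
have no boundary. -/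
lemma isWarpedAt_inChart :
    IsWarpedAt (gB.inChart p) (gF.inChart q) (c ∘ (extChartAt IB p).symm)
      (w ∘ (extChartAt IB p).symm) ((bcwp gB gF c w hc hw hc0 hw0).inChart (p, q))
      (extChartAt IB p p, extChartAt IF q q) where
  base := gB.isMetricAt_inChart p
  fiber := gF.isMetricAt_inChart q
  total := (bcwp gB gF c w hc hw hc0 hw0).isMetricAt_inChart (p, q)
  contDiffAt_conf := (hc.contDiffAt_comp_extChartAt_symm p).of_le ENat.LEInfty.out
  contDiffAt_warp := (hw.contDiffAt_comp_extChartAt_symm p).of_le ENat.LEInfty.out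
  conf_ne := (hc0 _).ne'
  warp_ne := (hw0 _).ne'
  eq := by
    have hB := (isOpen_extChartAt_target (I := IB) p).mem_nhds (mem_extChartAt_target p)
    have hF := (isOpen_extChartAt_target (I := IF) q).mem_nhds (mem_extChartAt_target q)
    filter_upwards [prod_mem_nhds hB hF] with z hz a b
    have hD := mfderivWithin_extChartAt_symm_prod (IB := IB) (IF := IF) p q z.1 z.2 hz.1 hz.2
    let DB : EB →L[ℝ] EB := mfderivWithin 𝓘(ℝ, EB) IB (extChartAt IB p).symm (Set.range IB) z.1
    let DF : EF →L[ℝ] EF := mfderivWithin 𝓘(ℝ, EF) IF (extChartAt IF q).symm (Set.range IF) z.2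
    have h : ∀ D : EB × EF →L[ℝ] EB × EF, D = DB.prodMap DF → ∀ a b : EB × EF,
        bcwpForm gB gF c w ((extChartAt IB p).symm z.1, (extChartAt IF q).symm z.2) (D a) (D b) =
          c ((extChartAt IB p).symm z.1) ^ 2 * gB.inChart p z.1 a.1 b.1
            + w ((extChartAt IB p).symm z.1) ^ 2 * gF.inChart q z.2 a.2 b.2 := by
      rintro _ rfl a b
      exact bcwpForm_apply gB gF c w _ _ (DB a.1) (DB b.1) (DF a.2) (DF b.2)
    exact h _ hD a b

end Warped

end

theorem mainTheorem3
    {EB : Type*} [NormedAddCommGroup EB] [NormedSpace ℝ EB] [FiniteDimensional ℝ EB]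
    {HB : Type*} [TopologicalSpace HB] (IB : ModelWithCorners ℝ EB HB) [IB.Boundaryless]
    {B : Type*} [TopologicalSpace B] [ChartedSpace HB B] [IsManifold IB ∞ B]
    {EF : Type*} [NormedAddCommGroup EF] [NormedSpace ℝ EF] [FiniteDimensional ℝ EF]
    {HF : Type*} [TopologicalSpace HF] (IF : ModelWithCorners ℝ EF HF) [IF.Boundaryless]
    {F : Type*} [TopologicalSpace F] [ChartedSpace HF F] [IsManifold IF ∞ F]
    (gB : PseudoRiemannianMetric IB B) (gF : PseudoRiemannianMetric IF F)
    (c w : B → ℝ) (hc : ContMDiff IB 𝓘(ℝ) ∞ c) (hw : ContMDiff IB 𝓘(ℝ) ∞ w)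
    (hc0 : ∀ p, 0 < c p) (hw0 : ∀ p, 0 < w p)
    (m k : ℕ) (hm : Module.finrank ℝ EB = m) (hk : Module.finrank ℝ EF = k)
    (p : B) (q : F) :
    (∀ X Y : TangentSpace IB p,
      (bcwp gB gF c w hc hw hc0 hw0).ricci (p, q) (liftBase p q X) (liftBase p q Y) =
        gB.ricci p X Y
        - ((m : ℝ) - 2) * (1 / c p) * gB.hessian c p X Y
        + 2 * ((m : ℝ) - 2) * (1 / c p ^ 2) * (mvfderiv IB c p X * mvfderiv IB c p Y)
        - (((m : ℝ) - 3) * (gB.val p (gB.grad c p) (gB.grad c p) / c p ^ 2)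
            + gB.laplacian c p / c p) * gB.val p X Y
        - (k : ℝ) * (1 / w p) * gB.hessian w p X Y
        - (k : ℝ) * (gB.val p (gB.grad w p) (gB.grad c p) / (w p * c p)) * gB.val p X Y
        + (k : ℝ) * (mvfderiv IB c p X / c p) * (mvfderiv IB w p Y / w p)
        + (k : ℝ) * (mvfderiv IB c p Y / c p) * (mvfderiv IB w p X / w p)) ∧
    (∀ (X : TangentSpace IB p) (V : TangentSpace IF q),
      (bcwp gB gF c w hc hw hc0 hw0).ricci (p, q) (liftBase p q X) (liftFiber p q V) = 0 ∧
      (bcwp gB gF c w hc hw hc0 hw0).ricci (p, q) (liftFiber p q V) (liftBase p q X) = 0) ∧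
    (∀ V W : TangentSpace IF q,
      (bcwp gB gF c w hc hw hc0 hw0).ricci (p, q) (liftFiber p q V) (liftFiber p q W) =
        gF.ricci q V W
        - (w p ^ 2 / c p ^ 2) * gF.val q V W *
          (((m : ℝ) - 2) * (gB.val p (gB.grad w p) (gB.grad c p) / (w p * c p))
            + gB.laplacian w p / w p
            + ((k : ℝ) - 1) * (gB.val p (gB.grad w p) (gB.grad w p) / w p ^ 2))) := by
  subst hm hk
  have h := isWarpedAt_inChart gB gF c w hc hw hc0 hw0 p q
  have hcp : (c ∘ (extChartAt IB p).symm) (extChartAt IB p p) = c p :=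
    congrArg c (extChartAt_to_inv p)
  have hwp : (w ∘ (extChartAt IB p).symm) (extChartAt IB p p) = w p :=
    congrArg w (extChartAt_to_inv p)
  refine ⟨fun X Y ↦ ?_, fun X V ↦ ⟨?_, ?_⟩, fun V W ↦ ?_⟩
  · rw [liftBase_eq, liftBase_eq]
    have h1 := h.ricci_base X Y
    rw [hcp, hwp, gB.grad_inChart hc, gB.grad_inChart hw, gB.inChart_center,
      fderiv_comp_extChartAt_symm hc, fderiv_comp_extChartAt_symm hw] at h1
    -- The remaining Ricci tensors, Hessians and Laplacians are by definition those of the chart.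
    exact h1
  · rw [liftBase_eq, liftFiber_eq]
    exact h.ricci_base_fiber X V
  · rw [liftBase_eq, liftFiber_eq]
    exact h.ricci_fiber_base X V
  · rw [liftFiber_eq, liftFiber_eq]
    have h1 := h.ricci_fiber V W
    rw [hcp, hwp, gB.grad_inChart hc, gB.grad_inChart hw, gB.inChart_center,
      gF.inChart_center] at h1
    exact h1
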